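/- Let $\mathcal A$ be a unital separable C$^*$-algebra and let $\mathcal B$ be a UHF algebra, that is, an infinite-dimensional unital C$^*$-algebra which is the norm closure of an increasing sequence of C$^*$-subalgebras, each containing the unit of $\mathcal B$ and each $*$-isomorphic to a full matrix algebra $M_k(\mathbb C)$ for some $k$. Then the C$^*$-algebra tensor product $\mathcal A\otimes\mathcal B$ (the completion of the algebraic tensor product in the minimal, i.e. spatial, C$^*$-norm) is singly generated: there are two self-adjoint elements $a,b\in\mathcal A\otimes\mathcal B$ such that $\mathcal A\otimes\mathcal B$ is the C$^*$-subalgebra generated by $a$ and $b$. -/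

import Mathlib

open scoped TensorProduct

universe u v

noncomputable section

/-- A C⋆-algebra is *singly generated* if it is generated, as a C⋆-algebra, by two self-adjoint
elements `a` and `b`: the norm closure of the (not necessarily unital) `⋆`-algebra of
non-commutative polynomials without constant term in `a` and `b` is everything.
(Equivalently, it is generated by the single element `a + i b`.) -/
def IsSinglyGenerated (C : Type*) [CStarAlgebra C] : Prop :=
  ∃ a b : C, IsSelfAdjoint a ∧ IsSelfAdjoint b ∧
    (NonUnitalStarAlgebra.adjoin ℂ ({a, b} : Set C)).topologicalClosure = ⊤

/-- A *UHF algebra*: an infinite-dimensional unital C⋆-algebra which is the norm closure of an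
increasing sequence of unital `⋆`-subalgebras, each `⋆`-isomorphic to a full matrix algebra
`M_k(ℂ)`. -/
structure IsUHF (B : Type*) [CStarAlgebra B] : Prop where
  infinite_dimensional : ¬ FiniteDimensional ℂ B
  exists_matrix_subalgebras : ∃ (S : ℕ → StarSubalgebra ℂ B) (k : ℕ → ℕ),
    Monotone S ∧
    (∀ n, Nonempty (S n ≃⋆ₐ[ℂ] Matrix (Fin (k n)) (Fin (k n)) ℂ)) ∧
    Dense (⋃ n, (S n : Set B))

namespace CStarTensor

/-- A pair of representations, `π` of `A` on a Hilbert space `H` and `σ` of `B` on a Hilbert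
space `K`. The universe levels are large enough for the Gelfand–Naimark–Segal representations
and for the universal representations of `A` and `B`. -/
structure RepPair (A : Type u) (B : Type v) [CStarAlgebra A] [CStarAlgebra B] where
  /-- the space of the representation of `A` -/
  H : Type u
  /-- the space of the representation of `B` -/
  K : Type v
  [normedH : NormedAddCommGroup H]
  [innerH : InnerProductSpace ℂ H]
  [completeH : CompleteSpace H]
  [normedK : NormedAddCommGroup K]
  [innerK : InnerProductSpace ℂ K]
  [completeK : CompleteSpace K]
  /-- the representation of `A` -/
  π : A →⋆ₐ[ℂ] (H →L[ℂ] H)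
  /-- the representation of `B` -/
  σ : B →⋆ₐ[ℂ] (K →L[ℂ] K)

attribute [instance] RepPair.normedH RepPair.innerH RepPair.completeH
  RepPair.normedK RepPair.innerK RepPair.completeK

variable {A : Type u} {B : Type v} [CStarAlgebra A] [CStarAlgebra B]

/-- The operator `(π ⊗ σ)(x) = ∑ π(aᵢ) ⊗ σ(bᵢ)`, for `x = ∑ aᵢ ⊗ bᵢ` in the algebraic tensor
product, on the algebraic tensor product `H ⊗ K` with its Hilbert space inner product. It has the
same norm as its extension to the Hilbert space tensor product, which is the completion of
`H ⊗ K`. -/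
def RepPair.op (r : RepPair A B) : A ⊗[ℂ] B →ₗ[ℂ] ((r.H ⊗[ℂ] r.K) →L[ℂ] (r.H ⊗[ℂ] r.K)) :=
  TensorProduct.lift (LinearMap.mk₂ ℂ (fun a b => TensorProduct.mapL (r.π a) (r.σ b))
    (fun a a' b => by rw [map_add, TensorProduct.mapL_add_left])
    (fun c a b => by rw [map_smul, TensorProduct.mapL_smul_left])
    (fun a b b' => by rw [map_add, TensorProduct.mapL_add_right])
    (fun c a b => by rw [map_smul, TensorProduct.mapL_smul_right]))

theorem RepPair.op_tmul (r : RepPair A B) (a : A) (b : B) :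
    r.op (a ⊗ₜ b) = TensorProduct.mapL (r.π a) (r.σ b) := rfl

/-- The minimal (spatial) C⋆-norm on the algebraic tensor product: the supremum of
`‖(π ⊗ σ)(x)‖` over all pairs of representations. -/
def minNorm (x : A ⊗[ℂ] B) : ℝ := ⨆ r : RepPair A B, ‖r.op x‖

theorem RepPair.op_mul (r : RepPair A B) (x y : A ⊗[ℂ] B) :
    r.op (x * y) = r.op x * r.op y := by
  induction x using TensorProduct.induction_on with
  | zero => simp
  | add x x' hx hx' => rw [add_mul, map_add, hx, hx', map_add, add_mul]
  | tmul a b =>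
    induction y using TensorProduct.induction_on with
    | zero => simp
    | add y y' hy hy' => rw [mul_add, map_add, hy, hy', map_add, mul_add]
    | tmul a' b' =>
      rw [Algebra.TensorProduct.tmul_mul_tmul, RepPair.op_tmul, RepPair.op_tmul,
        RepPair.op_tmul, map_mul, map_mul, TensorProduct.mapL_mul]

theorem RepPair.inner_op (r : RepPair A B) (x : A ⊗[ℂ] B) (v w : r.H ⊗[ℂ] r.K) :
    inner ℂ (r.op x v) w = inner ℂ v (r.op (star x) w) := by
  induction x using TensorProduct.induction_on with
  | zero => simp
  | add x x' hx hx' =>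
    simp only [map_add, star_add, add_apply, inner_add_left, inner_add_right,
      hx, hx']
  | tmul a b =>
    induction v using TensorProduct.induction_on with
    | zero => simp
    | add v v' hv hv' => simp only [map_add, inner_add_left, hv, hv']
    | tmul h k =>
      induction w using TensorProduct.induction_on with
      | zero => simp
      | add w w' hw hw' => simp only [map_add, inner_add_right, hw, hw']
      | tmul h' k' =>
        rw [TensorProduct.star_tmul, RepPair.op_tmul, RepPair.op_tmul, TensorProduct.mapL_tmul,
          TensorProduct.mapL_tmul, TensorProduct.inner_tmul, TensorProduct.inner_tmul,
          map_star, map_star, ContinuousLinearMap.star_eq_adjoint,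
          ContinuousLinearMap.star_eq_adjoint, ContinuousLinearMap.adjoint_inner_right,
          ContinuousLinearMap.adjoint_inner_right]

theorem RepPair.norm_op_sq_le (r : RepPair A B) (x : A ⊗[ℂ] B) :
    ‖r.op x‖ * ‖r.op x‖ ≤ ‖r.op (star x * x)‖ := by
  have hn : 0 ≤ ‖r.op (star x * x)‖ := ContinuousLinearMap.opNorm_nonneg _
  have h : ‖r.op x‖ ≤ Real.sqrt ‖r.op (star x * x)‖ := by
    refine ContinuousLinearMap.opNorm_le_bound _ (Real.sqrt_nonneg _) fun v => ?_
    refine abs_le_of_sq_le_sq' ?_ (by positivity) |>.2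
    rw [mul_pow, Real.sq_sqrt hn, ← inner_self_eq_norm_sq (𝕜 := ℂ), r.inner_op,
      ← mul_apply_eq_comp, ← r.op_mul]
    refine (RCLike.re_le_norm _).trans ((norm_inner_le_norm (𝕜 := ℂ) v _).trans ?_)
    calc ‖v‖ * ‖r.op (star x * x) v‖ ≤ ‖v‖ * (‖r.op (star x * x)‖ * ‖v‖) := by
          gcongr
          exact ContinuousLinearMap.le_opNorm _ _
      _ = ‖r.op (star x * x)‖ * ‖v‖ ^ 2 := by ring
  calc ‖r.op x‖ * ‖r.op x‖
      ≤ Real.sqrt ‖r.op (star x * x)‖ * Real.sqrt ‖r.op (star x * x)‖ :=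
        mul_self_le_mul_self (ContinuousLinearMap.opNorm_nonneg _) h
    _ = ‖r.op (star x * x)‖ := Real.mul_self_sqrt hn

theorem bddAbove (x : A ⊗[ℂ] B) : BddAbove (Set.range fun r : RepPair A B => ‖r.op x‖) := by
  induction x using TensorProduct.induction_on with
  | zero =>
    refine ⟨0, ?_⟩
    rintro _ ⟨r, rfl⟩
    simp only [map_zero]
    exact ContinuousLinearMap.opNorm_zero.le
  | add x y hx hy =>
    obtain ⟨c, hc⟩ := hx
    obtain ⟨d, hd⟩ := hy
    refine ⟨c + d, ?_⟩
    rintro _ ⟨r, rfl⟩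
    simp only [map_add]
    exact (ContinuousLinearMap.opNorm_add_le _ _).trans
      (add_le_add (hc (Set.mem_range_self r)) (hd (Set.mem_range_self r)))
  | tmul a b =>
    refine ⟨‖a‖ * ‖b‖, ?_⟩
    rintro _ ⟨r, rfl⟩
    refine (TensorProduct.norm_mapL_le _ _).trans ?_
    gcongr
    · exact NonUnitalStarAlgHom.norm_apply_le r.π a
    · exact NonUnitalStarAlgHom.norm_apply_le r.σ b

theorem norm_op_le (r : RepPair A B) (x : A ⊗[ℂ] B) : ‖r.op x‖ ≤ minNorm x :=
  le_ciSup (bddAbove x) r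

theorem minNorm_nonneg (x : A ⊗[ℂ] B) : 0 ≤ minNorm x :=
  Real.iSup_nonneg fun _ => ContinuousLinearMap.opNorm_nonneg _

theorem minNorm_add_le (x y : A ⊗[ℂ] B) : minNorm (x + y) ≤ minNorm x + minNorm y := by
  refine Real.iSup_le (fun r => ?_) (add_nonneg (minNorm_nonneg x) (minNorm_nonneg y))
  rw [map_add]
  exact (ContinuousLinearMap.opNorm_add_le _ _).trans (add_le_add (norm_op_le r x) (norm_op_le r y))

theorem minNorm_mul_le (x y : A ⊗[ℂ] B) : minNorm (x * y) ≤ minNorm x * minNorm y := by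
  refine Real.iSup_le (fun r => ?_) (mul_nonneg (minNorm_nonneg x) (minNorm_nonneg y))
  rw [RepPair.op_mul]
  exact (ContinuousLinearMap.opNorm_comp_le _ _).trans
    (mul_le_mul (norm_op_le r x) (norm_op_le r y) (ContinuousLinearMap.opNorm_nonneg _) (minNorm_nonneg x))

theorem minNorm_smul_le (c : ℂ) (x : A ⊗[ℂ] B) : minNorm (c • x) ≤ ‖c‖ * minNorm x := by
  refine Real.iSup_le (fun r => ?_) (mul_nonneg (norm_nonneg c) (minNorm_nonneg x))
  rw [map_smul]
  refine (ContinuousLinearMap.opNorm_smul_le _ _).trans ?_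
  exact mul_le_mul_of_nonneg_left (norm_op_le r x) (norm_nonneg c)

theorem minNorm_neg (x : A ⊗[ℂ] B) : minNorm (-x) = minNorm x := by
  have key : ∀ y : A ⊗[ℂ] B, minNorm (-y) ≤ minNorm y := fun y => by
    have := minNorm_smul_le (-1 : ℂ) y
    rwa [neg_one_smul, norm_neg, norm_one, one_mul] at this
  refine le_antisymm (key x) ?_
  have := key (-x)
  rwa [neg_neg] at this

theorem minNorm_mul_self_le (x : A ⊗[ℂ] B) :
    minNorm x * minNorm x ≤ minNorm (star x * x) := by
  have h : minNorm x ≤ Real.sqrt (minNorm (star x * x)) := by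
    refine Real.iSup_le (fun r => Real.le_sqrt_of_sq_le ?_) (Real.sqrt_nonneg _)
    rw [sq]
    exact (r.norm_op_sq_le x).trans (norm_op_le r _)
  calc minNorm x * minNorm x
      ≤ Real.sqrt (minNorm (star x * x)) * Real.sqrt (minNorm (star x * x)) :=
        mul_self_le_mul_self (minNorm_nonneg x) h
    _ = minNorm (star x * x) := Real.mul_self_sqrt (minNorm_nonneg _)

theorem minNorm_star_le (x : A ⊗[ℂ] B) : minNorm (star x) ≤ minNorm x := by
  by_contra! h
  have h1 := (minNorm_mul_self_le (star x)).trans (minNorm_mul_le _ _)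
  rw [star_star] at h1
  nlinarith [minNorm_nonneg x]

variable (A B) in
/-- The algebraic tensor product of `A` and `B`, to be equipped with the minimal C⋆-norm. -/
def Alg : Type (max u v) := A ⊗[ℂ] B

instance : Ring (Alg A B) := inferInstanceAs (Ring (A ⊗[ℂ] B))
instance : Algebra ℂ (Alg A B) := inferInstanceAs (Algebra ℂ (A ⊗[ℂ] B))

theorem star_mul_tensor (x y : A ⊗[ℂ] B) : star (x * y) = star y * star x := by
  induction x using TensorProduct.induction_on with
  | zero => simp
  | add x x' hx hx' => rw [add_mul, star_add, hx, hx', star_add, mul_add]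
  | tmul a b =>
    induction y using TensorProduct.induction_on with
    | zero => simp
    | add y y' hy hy' => rw [mul_add, star_add, hy, hy', star_add, add_mul]
    | tmul a' b' =>
      simp only [Algebra.TensorProduct.tmul_mul_tmul, TensorProduct.star_tmul, star_mul]

instance : StarAddMonoid (Alg A B) := inferInstanceAs (StarAddMonoid (A ⊗[ℂ] B))
instance : StarRing (Alg A B) where
  star_add := star_add
  star_mul := star_mul_tensor (A := A) (B := B)
instance : StarModule ℂ (Alg A B) := inferInstanceAs (StarModule ℂ (A ⊗[ℂ] B))

instance : Norm (Alg A B) := ⟨fun x => minNorm (A := A) (B := B) x⟩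

/-- The minimal norm, as a seminorm of additive groups. -/
def addGroupSeminorm : AddGroupSeminorm (Alg A B) where
  toFun x := minNorm (A := A) (B := B) x
  map_zero' := by
    have := minNorm_smul_le (0 : ℂ) (0 : A ⊗[ℂ] B)
    rw [zero_smul, norm_zero, zero_mul] at this
    exact le_antisymm this (minNorm_nonneg _)
  add_le' := minNorm_add_le (A := A) (B := B)
  neg' := minNorm_neg (A := A) (B := B)

instance : SeminormedAddCommGroup (Alg A B) :=
  AddGroupSeminorm.toSeminormedAddCommGroup addGroupSeminorm

instance : SeminormedRing (Alg A B) where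
  __ := (inferInstance : SeminormedAddCommGroup (Alg A B))
  __ := (inferInstance : Ring (Alg A B))
  norm_mul_le := minNorm_mul_le (A := A) (B := B)

instance : NormedAlgebra ℂ (Alg A B) where
  norm_smul_le := minNorm_smul_le (A := A) (B := B)

instance : NormedStarGroup (Alg A B) where
  norm_star_le := minNorm_star_le (A := A) (B := B)

end CStarTensor

open CStarTensor UniformSpace

/-- The C⋆-algebra tensor product `A ⊗ B`: the completion of the algebraic tensor product in the
minimal (spatial) C⋆-norm. -/
def CStarTensor (A : Type u) (B : Type v) [CStarAlgebra A] [CStarAlgebra B] : Type (max u v) :=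
  Completion (Alg A B)

namespace CStarTensor

variable {A : Type u} {B : Type v} [CStarAlgebra A] [CStarAlgebra B]

instance : NormedRing (CStarTensor A B) := inferInstanceAs (NormedRing (Completion (Alg A B)))
instance : CompleteSpace (CStarTensor A B) :=
  inferInstanceAs (CompleteSpace (Completion (Alg A B)))

instance : NormedAlgebra ℂ (CStarTensor A B) where
  __ := (inferInstance : Algebra ℂ (Completion (Alg A B)))
  norm_smul_le := norm_smul_le (α := ℂ) (β := Completion (Alg A B))

/-- The adjoint on the completion is the continuous extension of `(a ⊗ b)⋆ = a⋆ ⊗ b⋆`. -/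
instance : Star (CStarTensor A B) := ⟨Completion.map (star : Alg A B → Alg A B)⟩

/-- The canonical map from the algebraic tensor product to its completion. -/
def ofAlg (x : A ⊗[ℂ] B) : CStarTensor A B :=
  (Completion.coe' : Alg A B → Completion (Alg A B)) x

theorem uniformContinuous_star_alg : UniformContinuous (star : Alg A B → Alg A B) :=
  (starNormedAddGroupHom (E := Alg A B)).uniformContinuous

theorem star_ofAlg (x : A ⊗[ℂ] B) : star (ofAlg x) = ofAlg (star x) :=
  Completion.map_coe uniformContinuous_star_alg _

theorem norm_ofAlg (x : A ⊗[ℂ] B) : ‖ofAlg x‖ = minNorm x :=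
  Completion.norm_coe (E := Alg A B) x

theorem ofAlg_mul (x y : A ⊗[ℂ] B) : ofAlg (x * y) = ofAlg x * ofAlg y :=
  Completion.coe_mul (α := Alg A B) x y

theorem ofAlg_add (x y : A ⊗[ℂ] B) : ofAlg (x + y) = ofAlg x + ofAlg y :=
  Completion.coe_add (α := Alg A B) x y

theorem ofAlg_smul (c : ℂ) (x : A ⊗[ℂ] B) : ofAlg (c • x) = c • ofAlg x :=
  Completion.coe_smul (X := Alg A B) c x

theorem continuous_star' : Continuous (star : CStarTensor A B → CStarTensor A B) :=
  Completion.continuous_map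

theorem denseRange_ofAlg : DenseRange (ofAlg : A ⊗[ℂ] B → CStarTensor A B) :=
  Completion.denseRange_coe (α := Alg A B)

instance : StarRing (CStarTensor A B) where
  star_involutive x := by
    refine denseRange_ofAlg.induction_on (p := fun x => star (star x) = x) x
      (isClosed_eq (continuous_star'.comp continuous_star') continuous_id) fun x => ?_
    rw [star_ofAlg, star_ofAlg, star_star]
  star_mul x y := by
    refine denseRange_ofAlg.induction_on₂ (p := fun x y => star (x * y) = star y * star x)
      (isClosed_eq (continuous_star'.comp continuous_mul)
        ((continuous_star'.comp continuous_snd).mul (continuous_star'.comp continuous_fst)))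
      (fun x y => ?_) x y
    rw [← ofAlg_mul, star_ofAlg, star_ofAlg, star_ofAlg, ← ofAlg_mul, star_mul_tensor]
  star_add x y := by
    refine denseRange_ofAlg.induction_on₂ (p := fun x y => star (x + y) = star x + star y)
      (isClosed_eq (continuous_star'.comp continuous_add)
        ((continuous_star'.comp continuous_fst).add (continuous_star'.comp continuous_snd)))
      (fun x y => ?_) x y
    rw [← ofAlg_add, star_ofAlg, star_ofAlg, star_ofAlg, ← ofAlg_add, star_add]

instance : CStarAlgebra (CStarTensor A B) where
  norm_mul_self_le x := by
    refine denseRange_ofAlg.induction_on (p := fun x => ‖x‖ * ‖x‖ ≤ ‖star x * x‖) x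
      (isClosed_le (continuous_norm.mul continuous_norm)
        (continuous_norm.comp (continuous_star'.mul continuous_id))) fun x => ?_
    rw [star_ofAlg, ← ofAlg_mul, norm_ofAlg, norm_ofAlg]
    exact minNorm_mul_self_le x
  star_smul c x := by
    refine denseRange_ofAlg.induction_on (p := fun x => star (c • x) = star c • star x) x
      (isClosed_eq (continuous_star'.comp (continuous_const_smul c))
        ((continuous_const_smul (star c)).comp continuous_star')) fun x => ?_
    rw [← ofAlg_smul, star_ofAlg, star_ofAlg, ← ofAlg_smul, star_smul]

end CStarTensor

end

noncomputable section

open CStarTensor UniformSpace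

/-! ### Recovering many elements from one self-adjoint element -/

section Extraction

variable {C : Type*} [CStarAlgebra C]

/-! A UHF algebra has a tower of matrix units in which one diagonal unit `f n` of each stage is
split at the next stage into the smaller unit `f (n + 1)` and at least one further diagonal unit.
The units split off, over all stages, are countably many orthogonal projections. A rapidly
decreasing weighted sum of them, shifted by `1`, is the first generator `a`: powers of its tails
isolate the projections one by one (`exists_isSelfAdjoint_forall_mem_of_orthogonal`), and the shift
lets an algebra of polynomials without constant term recover the unit.

The second generator `b` is a weighted sum of self-adjoint `y n`, each living in the corner of `f n`
with zero compression to `f (n + 1)`. Thus `y n` occupies an L-shaped block, and cutting `b` by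
projections already recovered isolates pieces of `y n` (`exists_isSelfAdjoint_mul_mul_eq`). Off the
diagonal, `y n` carries the matrix units linking `f (n + 1)` to the other pieces of `f n`; these
generate the UHF factor (`MatrixTower.mem_of_forall_mem`). In one diagonal position it carries the
`n`-th term of a dense sequence of self-adjoint elements of the separable factor, which the matrix
units then spread over the whole diagonal.

Of the tensor product only two facts matter: the factors embed as commuting subalgebras, and their
products span a dense subspace. -/

theorem add_pow_succ_of_mul_eq_zero {R : Type*} [Ring R] {p r : R} (hp : p * p = p)
    (hpr : p * r = 0) (hrp : r * p = 0) (n : ℕ) : (p + r) ^ (n + 1) = p + r ^ (n + 1) := by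
  induction n with
  | zero => simp
  | succ n ih =>
    rw [pow_succ, ih, add_mul, mul_add, mul_add, hp, hpr, pow_succ r n, mul_assoc, hrp, mul_zero,
      pow_succ r (n + 1), pow_succ r n]
    abel

theorem NonUnitalStarSubalgebra.pow_succ_mem (T : NonUnitalStarSubalgebra ℂ C) {x : C}
    (hx : x ∈ T) (n : ℕ) : x ^ (n + 1) ∈ T := by
  induction n with
  | zero => simpa using hx
  | succ n ih => rw [pow_succ]; exact mul_mem ih hx

/-- A closed subalgebra containing an element at distance less than `1` from the unit contains
the unit. -/
theorem NonUnitalStarSubalgebra.one_mem_of_norm_lt_one (T : NonUnitalStarSubalgebra ℂ C)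
    (hT : IsClosed (T : Set C)) {x : C} (hx : ‖x‖ < 1) (h : 1 + x ∈ T) : (1 : C) ∈ T := by
  -- With `s = 1 + x`, the element `1 - (1 - s) ^ n` is a polynomial in `s` without constant term,
  -- so it lies in the algebra before the unit is known to.
  have hmem : ∀ n : ℕ, 1 - (-x) ^ n ∈ T := by
    intro n
    induction n with
    | zero => simp
    | succ n ih =>
      have : 1 - (-x) ^ (n + 1) = (1 + x) + (1 - (-x) ^ n) - (1 + x) * (1 - (-x) ^ n) := by
        rw [pow_succ']
        noncomm_ring
      rw [this]
      exact sub_mem (add_mem h ih) (mul_mem h ih)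
  have hlim : Filter.Tendsto (fun n : ℕ => 1 - (-x) ^ n) Filter.atTop (nhds (1 - 0 : C)) :=
    tendsto_const_nhds.sub (tendsto_pow_atTop_nhds_zero_of_norm_lt_one (by rwa [norm_neg]))
  rw [sub_zero] at hlim
  exact hT.mem_of_tendsto hlim (Filter.Eventually.of_forall hmem)

/-- If `p` is an idempotent orthogonal to a strict contraction `r`, then a closed subalgebra
containing `p + r` contains `p`. -/
theorem NonUnitalStarSubalgebra.mem_of_add_mem (T : NonUnitalStarSubalgebra ℂ C)
    (hT : IsClosed (T : Set C)) {p r : C} (hp : p * p = p) (hpr : p * r = 0) (hrp : r * p = 0)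
    (hr : ‖r‖ < 1) (h : p + r ∈ T) : p ∈ T := by
  have hlim : Filter.Tendsto (fun n : ℕ => p + r ^ (n + 1)) Filter.atTop (nhds (p + 0)) :=
    tendsto_const_nhds.add
      ((tendsto_pow_atTop_nhds_zero_of_norm_lt_one hr).comp (Filter.tendsto_add_atTop_nat 1))
  rw [add_zero] at hlim
  refine hT.mem_of_tendsto hlim (Filter.Eventually.of_forall fun n => ?_)
  change p + r ^ (n + 1) ∈ T
  rw [← add_pow_succ_of_mul_eq_zero hp hpr hrp]
  exact T.pow_succ_mem h n

/-- The tails `r m` of the weighted sum satisfy `4 r m = q m + r (m + 1)`, where the summands are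
orthogonal and the second is a strict contraction. Powers of `4 r m` therefore converge to `q m`;
subtracting it leaves the next tail, and the induction continues. -/
theorem exists_isSelfAdjoint_forall_mem_of_orthogonal_nat (q : ℕ → C)
    (hq : ∀ n, IsStarProjection (q n)) (ho : ∀ m n, m ≠ n → q m * q n = 0) :
    ∃ a : C, IsSelfAdjoint a ∧ ∀ T : NonUnitalStarSubalgebra ℂ C, IsClosed (T : Set C) →
      a ∈ T → 1 ∈ T ∧ ∀ n, q n ∈ T := by
  -- Ratio `1 / 4` bounds every tail by `1 / 3` through the triangle inequality alone; ratio `1 / 2`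
  -- would only give the bound `1`, which is not strict.
  set w : ℕ → ℂ := fun l => (1 / 4 : ℂ) ^ (l + 1) with hw
  have hn : ∀ m l, ‖w l • q (m + l)‖ ≤ (1 / 4 : ℝ) * (1 / 4) ^ l := by
    intro m l
    rw [norm_smul, hw, norm_pow, pow_succ']
    have h1 := (hq (m + l)).norm_le
    have h4 : ‖(1 / 4 : ℂ)‖ = 1 / 4 := by norm_num
    rw [h4]
    exact mul_le_of_le_one_right (by positivity) h1
  have hgeo : HasSum (fun l : ℕ => (1 / 4 : ℝ) * (1 / 4) ^ l) (1 / 3) := by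
    have := (hasSum_geometric_of_lt_one (r := (1 / 4 : ℝ)) (by norm_num) (by norm_num)).mul_left
      (1 / 4 : ℝ)
    rwa [show (1 / 4 : ℝ) * (1 - 1 / 4)⁻¹ = 1 / 3 by norm_num] at this
  have hs : ∀ m, Summable fun l => w l • q (m + l) := fun m =>
    Summable.of_norm_bounded hgeo.summable (hn m)
  set r : ℕ → C := fun m => ∑' l, w l • q (m + l) with hr
  have hrn : ∀ m, ‖r m‖ < 1 := fun m =>
    (tsum_of_norm_bounded hgeo (hn m)).trans_lt (by norm_num)
  have hrec : ∀ m, (4 : ℂ) • r m = q m + r (m + 1) := by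
    intro m
    have h4 : r m = (1 / 4 : ℂ) • q m + (1 / 4 : ℂ) • r (m + 1) := by
      simp only [hr]
      rw [(hs m).tsum_eq_zero_add, ← (hs (m + 1)).tsum_const_smul]
      congr 1
      · simp [hw]
      · refine tsum_congr fun l => ?_
        rw [smul_smul, add_right_comm m 1 l, add_assoc]
        simp only [hw]
        rw [pow_succ' _ (l + 1)]
    rw [h4, smul_add, smul_smul, smul_smul]
    norm_num
  have hqr : ∀ m, q m * r (m + 1) = 0 := by
    intro m
    simp only [hr]
    rw [← (hs (m + 1)).tsum_mul_left]
    simp only [mul_smul_comm, ho m _ (by lia : m ≠ m + 1 + _), smul_zero, tsum_zero]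
  have hrsa : ∀ m, IsSelfAdjoint (r m) := by
    intro m
    change star (r m) = r m
    simp only [hr]
    rw [tsum_star]
    refine tsum_congr fun l => ?_
    rw [star_smul, (hq _).isSelfAdjoint.star_eq]
    simp [hw]
  have hrq : ∀ m, r (m + 1) * q m = 0 := by
    intro m
    have := congrArg star (hqr m)
    rwa [star_mul, (hrsa _).star_eq, (hq m).isSelfAdjoint.star_eq, star_zero] at this
  refine ⟨1 + r 0, (IsSelfAdjoint.one C).add (hrsa 0), fun T hT ha => ?_⟩
  have h1 := T.one_mem_of_norm_lt_one hT (hrn 0) ha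
  refine ⟨h1, ?_⟩
  have hq_of : ∀ m, r m ∈ T → q m ∈ T := fun m hm =>
    T.mem_of_add_mem hT (hq m).isIdempotentElem (hqr m) (hrq m) (hrn _)
      (hrec m ▸ SMulMemClass.smul_mem (4 : ℂ) hm)
  have hrT : ∀ m, r m ∈ T := by
    intro m
    induction m with
    | zero => simpa using sub_mem ha h1
    | succ m ih =>
      rw [eq_sub_of_add_eq' (hrec m).symm]
      exact sub_mem (SMulMemClass.smul_mem (4 : ℂ) ih) (hq_of m ih)
  exact fun n => hq_of n (hrT n)

/-- Countably many orthogonal projections, and the unit, are encoded in one self-adjoint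
element. -/
theorem exists_isSelfAdjoint_forall_mem_of_orthogonal {J : Type*} [Countable J] (p : J → C)
    (hp : ∀ j, IsStarProjection (p j)) (ho : ∀ i j, i ≠ j → p i * p j = 0) :
    ∃ a : C, IsSelfAdjoint a ∧ ∀ T : NonUnitalStarSubalgebra ℂ C, IsClosed (T : Set C) →
      a ∈ T → 1 ∈ T ∧ ∀ j, p j ∈ T := by
  classical
  -- Naturals that are not indices receive the zero projection, which is orthogonal to everything;
  -- this covers finite index types too.
  obtain ⟨f, hf⟩ := exists_injective_nat J
  have key : ∀ n, (∃ j, f j = n ∧ Function.extend f p 0 n = p j) ∨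
      ((¬ ∃ j, f j = n) ∧ Function.extend f p 0 n = 0) := by
    intro n
    by_cases h : ∃ j, f j = n
    · obtain ⟨j, rfl⟩ := h
      exact Or.inl ⟨j, rfl, hf.extend_apply _ _ _⟩
    · exact Or.inr ⟨h, Function.extend_apply' _ _ _ h⟩
  obtain ⟨a, ha, H⟩ := exists_isSelfAdjoint_forall_mem_of_orthogonal_nat (Function.extend f p 0)
    (fun n => by
      obtain ⟨j, -, h⟩ | ⟨-, h⟩ := key n
      · exact h ▸ hp j
      · exact h ▸ IsStarProjection.zero C)
    (fun m n hmn => by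
      obtain ⟨j, hj, h⟩ | ⟨-, h⟩ := key m
      · obtain ⟨j', hj', h'⟩ | ⟨-, h'⟩ := key n
        · rw [h, h', ho]
          rintro rfl
          exact hmn (hj.symm.trans hj')
        · rw [h', mul_zero]
      · rw [h, zero_mul])
  refine ⟨a, ha, fun T hT haT => ?_⟩
  obtain ⟨h1, hq⟩ := H T hT haT
  exact ⟨h1, fun j => hf.extend_apply p 0 j ▸ hq (f j)⟩

/-- Let `f n` be a decreasing sequence of projections, and let the `y n` be self-adjoint elements
of the corners of the `f n`, with zero compression to `f (n + 1)`. Then the `y n` are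
encoded in one self-adjoint element, up to cutting with elements supported under `f n`, one of
them orthogonal to `f (n + 1)`. -/
theorem exists_isSelfAdjoint_mul_mul_eq (f y : ℕ → C) (hf : ∀ m n, m ≤ n → f m * f n = f n)
    (hf' : ∀ m n, m ≤ n → f n * f m = f n) (hy : ∀ n, IsSelfAdjoint (y n))
    (hfy : ∀ n, f n * y n = y n) (hcorner : ∀ n, f (n + 1) * y n * f (n + 1) = 0) :
    ∃ b : C, IsSelfAdjoint b ∧ ∀ n, ∃ c : ℂ, c ≠ 0 ∧ ∀ p q : C, p * f n = p → f n * q = q →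
      p * f (n + 1) = 0 → p * b * q = c • (p * y n * q) := by
  -- The weights force convergence without any bound on `y`. They are real, to keep the sum
  -- self-adjoint, and nonzero, so that a cut can be rescaled.
  set w : ℕ → ℝ := fun n => (1 / 2) ^ n / (1 + ‖y n‖) with hw
  have hw0 : ∀ n, 0 < w n := fun n => by positivity
  have hbound : ∀ n, ‖(w n : ℂ) • y n‖ ≤ (1 / 2 : ℝ) ^ n := by
    intro n
    rw [norm_smul, Complex.norm_real, Real.norm_of_nonneg (hw0 n).le, hw]
    simp only
    rw [div_mul_eq_mul_div, div_le_iff₀ (by positivity)]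
    gcongr
    linarith
  have hs : Summable fun n => (w n : ℂ) • y n :=
    Summable.of_norm_bounded (summable_geometric_of_lt_one (by norm_num) (by norm_num)) hbound
  refine ⟨∑' n, (w n : ℂ) • y n, ?_, fun n => ⟨w n, by exact_mod_cast (hw0 n).ne', ?_⟩⟩
  · change star _ = _
    rw [tsum_star]
    refine tsum_congr fun n => ?_
    rw [star_smul, (hy n).star_eq]
    simp
  · intro p q hp hq hpf
    rw [← hs.tsum_mul_left, ← (hs.mul_left p).tsum_mul_right, tsum_eq_single n]
    · simp
    · intro m hm
      rw [mul_smul_comm, smul_mul_assoc]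
      -- For `m < n`, both `p` and `q` lie under `f (m + 1)`, where `y m` compresses to zero; for `m
      -- > n`, `y m` lies under `f (n + 1)`, which `p` annihilates.
      obtain h | h := lt_or_gt_of_ne hm
      · have hp' : p * f (m + 1) = p := by rw [← hp, mul_assoc, hf' _ _ h]
        have hq' : f (m + 1) * q = q := by rw [← hq, ← mul_assoc, hf _ _ h]
        rw [← hp', ← hq', show p * f (m + 1) * y m * (f (m + 1) * q) =
          p * (f (m + 1) * y m * f (m + 1)) * q by noncomm_ring, hcorner]
        simp
      · have hpm : p * f m = 0 := by rw [← hf _ _ h, ← mul_assoc, hpf, zero_mul]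
        rw [← hfy m, ← mul_assoc, hpm]
        simp

end Extraction

/-! ### Matrix units and projections in matrix algebras -/

section MatrixUnits

/-- A system of matrix units in a unital `⋆`-ring. -/
structure IsMatrixUnits {ι R : Type*} [Fintype ι] [DecidableEq ι] [Ring R] [StarRing R]
    (e : ι → ι → R) : Prop where
  mul_same : ∀ i j l, e i j * e j l = e i l
  mul_of_ne : ∀ i j j' l, j ≠ j' → e i j * e j' l = 0
  star_eq : ∀ i j, star (e i j) = e j i
  sum_eq : ∑ i, e i i = 1

namespace IsMatrixUnits

variable {ι R : Type*} [Fintype ι] [DecidableEq ι] [Ring R] [StarRing R] {e : ι → ι → R}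

theorem isStarProjection (h : IsMatrixUnits e) (i : ι) : IsStarProjection (e i i) :=
  ⟨h.mul_same i i i, h.star_eq i i⟩

theorem map {S : Type*} [Ring S] [StarRing S] [Algebra ℂ R] [Algebra ℂ S] (h : IsMatrixUnits e)
    (φ : R →⋆ₐ[ℂ] S) : IsMatrixUnits fun i j => φ (e i j) where
  mul_same i j l := by rw [← map_mul, h.mul_same]
  mul_of_ne i j j' l hj := by rw [← map_mul, h.mul_of_ne _ _ _ _ hj, map_zero]
  star_eq i j := by rw [← map_star, h.star_eq]
  sum_eq := by rw [← map_sum, h.sum_eq, map_one]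

theorem single (k : ℕ) :
    IsMatrixUnits fun i j : Fin k => (Matrix.single i j 1 : Matrix (Fin k) (Fin k) ℂ) where
  mul_same i j l := by simp
  mul_of_ne i j j' l hj := Matrix.single_mul_single_of_ne _ _ _ _ hj _
  star_eq i j := by simp [Matrix.star_eq_conjTranspose]
  sum_eq := Matrix.sum_single_one

theorem sum_mul_of_mem (h : IsMatrixUnits e) {D : Finset ι} {i : ι} (hi : i ∈ D) (j : ι) :
    (∑ l ∈ D, e l l) * e i j = e i j := by
  rw [Finset.sum_mul, Finset.sum_eq_single_of_mem i hi, h.mul_same]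
  exact fun l _ hl => h.mul_of_ne _ _ _ _ hl

theorem sum_mul_of_notMem (h : IsMatrixUnits e) {D : Finset ι} {i : ι} (hi : i ∉ D) (j : ι) :
    (∑ l ∈ D, e l l) * e i j = 0 := by
  rw [Finset.sum_mul]
  exact Finset.sum_eq_zero fun l hl => h.mul_of_ne _ _ _ _ fun h => hi (h ▸ hl)

theorem mul_sum_of_mem (h : IsMatrixUnits e) {D : Finset ι} {i : ι} (hi : i ∈ D) (j : ι) :
    e j i * (∑ l ∈ D, e l l) = e j i := by
  rw [Finset.mul_sum, Finset.sum_eq_single_of_mem i hi, h.mul_same]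
  exact fun l _ hl => h.mul_of_ne _ _ _ _ hl.symm

theorem mul_sum_of_notMem (h : IsMatrixUnits e) {D : Finset ι} {i : ι} (hi : i ∉ D) (j : ι) :
    e j i * (∑ l ∈ D, e l l) = 0 := by
  rw [Finset.mul_sum]
  exact Finset.sum_eq_zero fun l hl => h.mul_of_ne _ _ _ _ fun h => hi (h ▸ hl)

/-- An element is recovered from its compressions to the corner of one of the matrix units. -/
theorem eq_sum_sum (h : IsMatrixUnits e) (z : ι) (x : R) :
    x = ∑ i, ∑ j, e i z * (e z z * (e z i * x * e j z) * e z z) * e z j := by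
  have key : ∀ i j, e i z * (e z z * (e z i * x * e j z) * e z z) * e z j = e i i * x * e j j := by
    intro i j
    calc _ = (e i z * e z z * e z i) * x * (e j z * e z z * e z j) := by noncomm_ring
      _ = _ := by simp only [h.mul_same]
  simp only [key, ← Finset.mul_sum, ← Finset.sum_mul, h.sum_eq, one_mul, mul_one]

/-- This is the minimality of a diagonal unit: among the `e i j`, only `e z z` survives the
compression. It is used to show that a unit which does not split leaves no room for a larger
algebra. -/
theorem corner_mem_span [Algebra ℂ R] (h : IsMatrixUnits e) (z : ι) {y : R}
    (hy : y ∈ Submodule.span ℂ (Set.range fun p : ι × ι => e p.1 p.2)) :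
    ∃ c : ℂ, e z z * y * e z z = c • e z z := by
  induction hy using Submodule.span_induction with
  | mem y hy =>
    obtain ⟨⟨i, j⟩, rfl⟩ := hy
    by_cases hi : i = z
    · by_cases hj : j = z
      · subst hi; subst hj
        exact ⟨1, by simp [h.mul_same]⟩
      · exact ⟨0, by simp [mul_assoc, h.mul_of_ne _ _ _ _ hj]⟩
    · exact ⟨0, by simp [h.mul_of_ne _ _ _ _ (Ne.symm hi)]⟩
  | zero => exact ⟨0, by simp⟩
  | add x y _ _ hx hy =>
    obtain ⟨c, hc⟩ := hx
    obtain ⟨d, hd⟩ := hy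
    exact ⟨c + d, by rw [mul_add, add_mul, hc, hd, add_smul]⟩
  | smul a x _ hx =>
    obtain ⟨c, hc⟩ := hx
    exact ⟨a * c, by rw [mul_smul_comm, smul_mul_assoc, hc, smul_smul]⟩

end IsMatrixUnits

/-- A projection in a full matrix algebra is a sum of diagonal matrix units, in a suitable
orthonormal basis. -/
theorem Matrix.exists_starAlgEquiv_isStarProjection {k : ℕ} {P : Matrix (Fin k) (Fin k) ℂ}
    (hP : IsStarProjection P) :
    ∃ (ψ : Matrix (Fin k) (Fin k) ℂ ≃⋆ₐ[ℂ] Matrix (Fin k) (Fin k) ℂ) (D : Finset (Fin k)),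
      ψ P = ∑ i ∈ D, Matrix.single i i 1 := by
  have hA : P.IsHermitian := hP.isSelfAdjoint
  set ψ := Unitary.conjStarAlgAut ℂ (Matrix (Fin k) (Fin k) ℂ) (star hA.eigenvectorUnitary)
  have hψ : ψ P = Matrix.diagonal (RCLike.ofReal ∘ hA.eigenvalues) :=
    hA.conjStarAlgAut_star_eigenvectorUnitary
  refine ⟨ψ, Finset.univ.filter fun i => hA.eigenvalues i = 1, ?_⟩
  have hid : ψ P * ψ P = ψ P := by rw [← map_mul, hP.isIdempotentElem.eq]
  have hev : ∀ i, hA.eigenvalues i = 0 ∨ hA.eigenvalues i = 1 := by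
    intro i
    rw [hψ, Matrix.diagonal_mul_diagonal] at hid
    have := congrFun (congrFun hid i) i
    simp only [Matrix.diagonal_apply_eq, Function.comp_apply] at this
    have h' : hA.eigenvalues i * hA.eigenvalues i = hA.eigenvalues i := by exact_mod_cast this
    grind
  rw [hψ, ← Matrix.sum_single_eq_diagonal, Finset.sum_filter]
  refine Finset.sum_congr rfl fun i _ => ?_
  rcases hev i with h | h <;> simp [h]

end MatrixUnits

/-! ### Towers of matrix units in a UHF algebra -/

section Tower

variable {B : Type*} [CStarAlgebra B]

/-- The linear span of a family of matrix units. -/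
abbrev matrixSpan {k : ℕ} (e : Fin k → Fin k → B) : Submodule ℂ B :=
  Submodule.span ℂ (Set.range fun p : Fin k × Fin k => e p.1 p.2)

/-- If a full matrix subalgebra `S` contains matrix units `e` that do not span it, then there are
matrix units spanning `S` for which a diagonal unit of `e` splits nontrivially. -/
theorem IsMatrixUnits.exists_refinement {k k' : ℕ} {e : Fin k → Fin k → B} (he : IsMatrixUnits e)
    (z : Fin k) (S : StarSubalgebra ℂ B) (φ : S ≃⋆ₐ[ℂ] Matrix (Fin k') (Fin k') ℂ)
    (heS : ∀ i j, e i j ∈ S) {x : B} (hxS : x ∈ S) (hx : x ∉ matrixSpan e) :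
    ∃ (e' : Fin k' → Fin k' → B) (D : Finset (Fin k')) (z' w : Fin k'), IsMatrixUnits e' ∧
      (∀ y, y ∈ S ↔ y ∈ matrixSpan e') ∧ e z z = ∑ i ∈ D, e' i i ∧ z' ∈ D ∧ w ∈ D ∧ w ≠ z' := by
  have hproj : IsStarProjection (⟨e z z, heS z z⟩ : S) :=
    ⟨Subtype.ext (he.mul_same z z z), Subtype.ext (he.star_eq z z)⟩
  obtain ⟨ψ, D, hD⟩ := Matrix.exists_starAlgEquiv_isStarProjection (hproj.map φ)
  set χ := (φ.trans ψ).symm with hχ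
  have hχD : χ (∑ i ∈ D, Matrix.single i i 1) = ⟨e z z, heS z z⟩ := by
    rw [← hD]
    exact (φ.trans ψ).symm_apply_apply _
  set e' : Fin k' → Fin k' → B := fun i j => (χ (Matrix.single i j 1) : S) with he'def
  have he' : IsMatrixUnits e' :=
    ((IsMatrixUnits.single k').map (χ : Matrix (Fin k') (Fin k') ℂ →⋆ₐ[ℂ] S)).map S.subtype
  have hspan : ∀ y, y ∈ S ↔ y ∈ matrixSpan e' := by
    intro y
    constructor
    · intro hy
      have : y = χ (χ.symm ⟨y, hy⟩) := by simp
      rw [this, Matrix.matrix_eq_sum_single (χ.symm ⟨y, hy⟩)]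
      simp only [map_sum, AddSubmonoidClass.coe_finsetSum]
      refine Submodule.sum_mem _ fun i _ => Submodule.sum_mem _ fun j _ => ?_
      have h1 : ∀ c : ℂ, (Matrix.single i j c : Matrix (Fin k') (Fin k') ℂ) =
          c • Matrix.single i j 1 := fun c => by simp [Matrix.smul_single]
      rw [h1, map_smul]
      exact Submodule.smul_mem _ _ (Submodule.subset_span ⟨(i, j), rfl⟩)
    · intro hy
      refine Submodule.span_induction (p := fun y _ => y ∈ S) ?_ (zero_mem S)
        (fun _ _ _ _ => add_mem) (fun c _ _ h => S.smul_mem h c) hy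
      rintro _ ⟨p, rfl⟩
      exact (χ (Matrix.single p.1 p.2 1)).2
  have hf : e z z = ∑ i ∈ D, e' i i := by
    have := congrArg (Subtype.val) hχD
    rw [map_sum] at this
    simpa [he'def] using this.symm
  -- An empty `D` would give `e z z = 0`, hence `x = 0`, which lies in the span.
  have hD0 : D.Nonempty := by
    rw [Finset.nonempty_iff_ne_empty]
    rintro rfl
    rw [Finset.sum_empty] at hf
    apply hx
    rw [he.eq_sum_sum z x]
    simp [hf]
  obtain ⟨z', hz'⟩ := hD0
  by_cases hw : ∃ w ∈ D, w ≠ z'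
  · obtain ⟨w, hw, hwz⟩ := hw
    exact ⟨e', D, z', w, he', hspan, hf, hz', hw, hwz⟩
  -- If `e z z` is a single diagonal unit of `e'`, its corner in `S` is scalar, and the expansion of
  -- `x` through that corner puts `x` in the span of `e`.
  · exfalso
    push Not at hw
    have hDs : D = {z'} := Finset.eq_singleton_iff_unique_mem.mpr ⟨hz', hw⟩
    rw [hDs, Finset.sum_singleton] at hf
    apply hx
    rw [he.eq_sum_sum z x]
    refine Submodule.sum_mem _ fun i _ => Submodule.sum_mem _ fun j _ => ?_
    obtain ⟨c, hc⟩ := he'.corner_mem_span z'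
      ((hspan _).1 (mul_mem (mul_mem (heS z i) hxS) (heS j z)))
    rw [← hf] at hc
    rw [hc, mul_smul_comm, smul_mul_assoc, he.mul_same, he.mul_same]
    exact Submodule.smul_mem _ _ (Submodule.subset_span ⟨(i, j), rfl⟩)

/-- A tower of matrix units in a C⋆-algebra with dense union: a distinguished diagonal unit
`e n (z n) (z n)` of each stage is split by the next stage, and the two distinguished indices
`z (n + 1)` and `w n` occur in the splitting. -/
structure MatrixTower (B : Type*) [CStarAlgebra B] where
  /-- the sizes of the matrix units -/
  k : ℕ → ℕ
  /-- the matrix units -/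
  e : ∀ n, Fin (k n) → Fin (k n) → B
  /-- the distinguished index -/
  z : ∀ n, Fin (k n)
  /-- the indices of the units under the distinguished unit of the preceding stage -/
  D : ∀ n, Finset (Fin (k (n + 1)))
  /-- a second index under the distinguished unit of the preceding stage -/
  w : ∀ n, Fin (k (n + 1))
  isMatrixUnits : ∀ n, IsMatrixUnits (e n)
  e_zero : ∀ i j, e 0 i j = 1
  e_z : ∀ n, e n (z n) (z n) = ∑ i ∈ D n, e (n + 1) i i
  z_mem : ∀ n, z (n + 1) ∈ D n
  w_mem : ∀ n, w n ∈ D n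
  w_ne : ∀ n, w n ≠ z (n + 1)
  mem_span : ∀ n i j, e n i j ∈ matrixSpan (e (n + 1))
  dense : Dense (⋃ n, (matrixSpan (e n) : Set B))

/-- A stage in the construction of a tower of matrix units. -/
structure MatrixStage (S : ℕ → StarSubalgebra ℂ B) where
  /-- an index with `e i j ∈ S n` -/
  n : ℕ
  /-- the size of the matrix units -/
  k : ℕ
  /-- the matrix units -/
  e : Fin k → Fin k → B
  /-- the distinguished index -/
  z : Fin k
  isMatrixUnits : IsMatrixUnits e
  mem : ∀ i j, e i j ∈ S n

/-- The span of the current matrix units is finite-dimensional, hence closed and proper, so some `S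
n` is not contained in it; in a later algebra the distinguished unit must then split. -/
theorem MatrixStage.exists_next {S : ℕ → StarSubalgebra ℂ B} {k : ℕ → ℕ} (hmono : Monotone S)
    (hiso : ∀ n, Nonempty (S n ≃⋆ₐ[ℂ] Matrix (Fin (k n)) (Fin (k n)) ℂ))
    (hdense : Dense (⋃ n, (S n : Set B))) (hinf : ¬ FiniteDimensional ℂ B) (s : MatrixStage S) :
    ∃ (t : MatrixStage S) (D : Finset (Fin t.k)) (w : Fin t.k), s.n < t.n ∧
      (∀ y ∈ S t.n, y ∈ matrixSpan t.e) ∧ s.e s.z s.z = ∑ i ∈ D, t.e i i ∧ t.z ∈ D ∧ w ∈ D ∧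
        w ≠ t.z := by
  obtain ⟨x, n, hxn, hx⟩ : ∃ x, ∃ n, x ∈ S n ∧ x ∉ matrixSpan s.e := by
    by_contra! h
    have hfin : FiniteDimensional ℂ (matrixSpan s.e) :=
      FiniteDimensional.span_of_finite ℂ (Set.finite_range _)
    have hclosed : IsClosed (matrixSpan s.e : Set B) := Submodule.closed_of_finiteDimensional _
    have htop : matrixSpan s.e = ⊤ := by
      rw [eq_top_iff]
      intro y _
      have : closure (⋃ n, (S n : Set B)) ⊆ matrixSpan s.e :=
        closure_minimal (Set.iUnion_subset fun n y hy => h y n hy) hclosed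
      exact this (hdense y)
    rw [htop] at hfin
    exact hinf (Module.Finite.equiv (Submodule.topEquiv (R := ℂ) (M := B)))
  -- The bound `s.n + 1` makes the indices strictly increase, so that the stages exhaust all the `S
  -- n`.
  set m := max n (s.n + 1)
  obtain ⟨φ⟩ := hiso m
  obtain ⟨e', D, z', w, he', hspan, hf, hz', hw, hwz⟩ := s.isMatrixUnits.exists_refinement s.z (S m)
    φ (fun i j => hmono (by lia : s.n ≤ m) (s.mem i j)) (hmono (le_max_left _ _) hxn) hx
  exact ⟨⟨m, k m, e', z', he', fun i j => (hspan _).2 (Submodule.subset_span ⟨(i, j), rfl⟩)⟩, D, w,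
    by simp only [m]; lia, fun y hy => (hspan y).1 hy, hf, hz', hw, hwz⟩

theorem IsUHF.nonempty_matrixTower (hB : IsUHF B) : Nonempty (MatrixTower B) := by
  obtain ⟨hinf, S, k, hmono, hiso, hdense⟩ := hB
  choose nxt D w hlt hspan hsum hz hw hwz using
    MatrixStage.exists_next hmono hiso hdense hinf
  -- The tower starts with the `1 × 1` system, so that `f 0 = 1`.
  let s₀ : MatrixStage S :=
    { n := 0
      k := 1
      e := fun _ _ => 1
      z := 0
      isMatrixUnits :=
        { mul_same := fun _ _ _ => one_mul 1
          mul_of_ne := fun _ j j' _ h => (h (Subsingleton.elim j j')).elim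
          star_eq := fun _ _ => star_one B
          sum_eq := by simp }
      mem := fun _ _ => one_mem _ }
  let s : ℕ → MatrixStage S := fun n => Nat.rec s₀ (fun _ t => nxt t) n
  have hsn : ∀ n, n ≤ (s n).n := by
    intro n
    induction n with
    | zero => exact Nat.zero_le _
    | succ n ih => exact lt_of_le_of_lt ih (hlt (s n))
  refine ⟨⟨fun n => (s n).k, fun n => (s n).e, fun n => (s n).z, fun n => D (s n),
    fun n => w (s n), fun n => (s n).isMatrixUnits, fun _ _ => rfl, fun n => hsum (s n),
    fun n => hz (s n), fun n => hw (s n), fun n => hwz (s n), ?_, ?_⟩⟩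
  · exact fun n i j => hspan (s n) _ (hmono (hlt (s n)).le ((s n).mem i j))
  · refine hdense.mono (Set.iUnion_subset fun n y hy => Set.mem_iUnion.2 ⟨n + 1, ?_⟩)
    exact hspan (s n) _ (hmono ((hsn n).trans (hlt (s n)).le) hy)

end Tower

/-! ### Corners, links and orthogonal projections of a tower -/

namespace MatrixTower

variable {B : Type*} [CStarAlgebra B] (t : MatrixTower B)

/-- The distinguished diagonal unit of a stage. -/
def f (n : ℕ) : B := t.e n (t.z n) (t.z n)

/-- The sum of the off-diagonal matrix units linking the distinguished unit to the other units
in the splitting of the preceding distinguished unit. -/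
def link (n : ℕ) : B :=
  ∑ i ∈ (t.D n).erase (t.z (n + 1)),
    (t.e (n + 1) i (t.z (n + 1)) + t.e (n + 1) (t.z (n + 1)) i)

/-- The diagonal units that split off from the distinguished units. -/
abbrev Index : Type := Σ n : ℕ, {i : Fin (t.k (n + 1)) // i ∈ (t.D n).erase (t.z (n + 1))}

/-- The projections indexed by `t.Index`. -/
def proj (j : t.Index) : B := t.e (j.1 + 1) j.2 j.2

theorem f_zero : t.f 0 = 1 := t.e_zero _ _

theorem isStarProjection_f (n : ℕ) : IsStarProjection (t.f n) :=
  (t.isMatrixUnits n).isStarProjection _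

theorem f_mul_e {n : ℕ} {i : Fin (t.k (n + 1))} (hi : i ∈ t.D n) (j : Fin (t.k (n + 1))) :
    t.f n * t.e (n + 1) i j = t.e (n + 1) i j := by
  rw [f, t.e_z, (t.isMatrixUnits _).sum_mul_of_mem hi]

theorem e_mul_f {n : ℕ} {i : Fin (t.k (n + 1))} (hi : i ∈ t.D n) (j : Fin (t.k (n + 1))) :
    t.e (n + 1) j i * t.f n = t.e (n + 1) j i := by
  rw [f, t.e_z, (t.isMatrixUnits _).mul_sum_of_mem hi]

theorem f_mul_f_succ (n : ℕ) : t.f n * t.f (n + 1) = t.f (n + 1) := t.f_mul_e (t.z_mem n) _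

theorem f_mul_f {m n : ℕ} (h : m ≤ n) : t.f m * t.f n = t.f n := by
  induction n, h using Nat.le_induction with
  | base => exact (t.isStarProjection_f m).isIdempotentElem
  | succ n _ ih => rw [← t.f_mul_f_succ n, ← mul_assoc, ih]

theorem f_mul_f' {m n : ℕ} (h : m ≤ n) : t.f n * t.f m = t.f n := by
  have := congrArg star (t.f_mul_f h)
  rwa [star_mul, (t.isStarProjection_f m).isSelfAdjoint.star_eq,
    (t.isStarProjection_f n).isSelfAdjoint.star_eq] at this

/-- This recovers every `f n` from the unit and the split-off projections. -/
theorem f_succ (n : ℕ) :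
    t.f (n + 1) = t.f n - ∑ i ∈ (t.D n).erase (t.z (n + 1)), t.e (n + 1) i i := by
  rw [f, f, t.e_z n, ← Finset.add_sum_erase _ _ (t.z_mem n), add_sub_cancel_right]

theorem isSelfAdjoint_link (n : ℕ) : IsSelfAdjoint (t.link n) := by
  rw [isSelfAdjoint_iff, link, star_sum]
  refine Finset.sum_congr rfl fun i _ => ?_
  rw [star_add, (t.isMatrixUnits _).star_eq, (t.isMatrixUnits _).star_eq, add_comm]

theorem f_mul_link (n : ℕ) : t.f n * t.link n = t.link n := by
  rw [link, Finset.mul_sum]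
  refine Finset.sum_congr rfl fun i hi => ?_
  rw [mul_add, t.f_mul_e (Finset.mem_of_mem_erase hi), t.f_mul_e (t.z_mem n)]

theorem f_succ_mul_link_mul (n : ℕ) : t.f (n + 1) * t.link n * t.f (n + 1) = 0 := by
  rw [link, Finset.mul_sum, Finset.sum_mul]
  refine Finset.sum_eq_zero fun i hi => ?_
  have hne := Finset.ne_of_mem_erase hi
  have h := t.isMatrixUnits (n + 1)
  rw [f, mul_add, add_mul, h.mul_of_ne _ _ _ _ hne.symm, mul_assoc, h.mul_of_ne _ _ _ _ hne]
  simp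

theorem e_mul_f_succ {n : ℕ} {i : Fin (t.k (n + 1))} (hi : i ∈ (t.D n).erase (t.z (n + 1)))
    (j : Fin (t.k (n + 1))) : t.e (n + 1) j i * t.f (n + 1) = 0 :=
  (t.isMatrixUnits _).mul_of_ne _ _ _ _ (Finset.ne_of_mem_erase hi)

theorem f_succ_mul_e {n : ℕ} {i : Fin (t.k (n + 1))} (hi : i ∈ (t.D n).erase (t.z (n + 1)))
    (j : Fin (t.k (n + 1))) : t.f (n + 1) * t.e (n + 1) i j = 0 :=
  (t.isMatrixUnits _).mul_of_ne _ _ _ _ (Finset.ne_of_mem_erase hi).symm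

theorem e_mul_link_mul_f {n : ℕ} {i : Fin (t.k (n + 1))}
    (hi : i ∈ (t.D n).erase (t.z (n + 1))) :
    t.e (n + 1) i i * t.link n * t.f (n + 1) = t.e (n + 1) i (t.z (n + 1)) := by
  have h := t.isMatrixUnits (n + 1)
  rw [link, Finset.mul_sum, Finset.sum_mul, Finset.sum_eq_single_of_mem i hi]
  · rw [f, mul_add, add_mul, h.mul_same, h.mul_same,
      h.mul_of_ne _ _ _ _ (Finset.ne_of_mem_erase hi), zero_mul, add_zero]
  · intro j _ hj
    rw [mul_add, h.mul_of_ne _ _ _ _ hj.symm, h.mul_of_ne _ _ _ _ (Finset.ne_of_mem_erase hi)]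
    simp

theorem e_mul_link_mul_e {n : ℕ} {i : Fin (t.k (n + 1))}
    (hi : i ∈ (t.D n).erase (t.z (n + 1))) :
    t.e (n + 1) i i * t.link n * t.e (n + 1) i i = 0 := by
  have h := t.isMatrixUnits (n + 1)
  rw [link, Finset.mul_sum, Finset.sum_mul]
  refine Finset.sum_eq_zero fun j _ => ?_
  rw [mul_add, h.mul_of_ne i i _ j (Finset.ne_of_mem_erase hi), add_zero, mul_assoc,
    h.mul_of_ne _ _ _ _ (Finset.ne_of_mem_erase hi).symm, mul_zero]

theorem isStarProjection_proj (j : t.Index) : IsStarProjection (t.proj j) :=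
  (t.isMatrixUnits _).isStarProjection _

theorem proj_mul_f (j : t.Index) : t.proj j * t.f j.1 = t.proj j :=
  t.e_mul_f (Finset.mem_of_mem_erase j.2.2) _

theorem f_mul_proj (j : t.Index) : t.f j.1 * t.proj j = t.proj j :=
  t.f_mul_e (Finset.mem_of_mem_erase j.2.2) _

/-- At different stages, the later projection lies under `f (m + 1)` for the earlier stage `m`, and
a projection split off at stage `m` is orthogonal to `f (m + 1)`. -/
theorem proj_mul_proj {i j : t.Index} (hij : i ≠ j) : t.proj i * t.proj j = 0 := by
  obtain ⟨m, i, hi⟩ := i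
  obtain ⟨n, j, hj⟩ := j
  rcases lt_trichotomy m n with h | rfl | h
  · rw [← t.f_mul_proj ⟨n, j, hj⟩, ← t.f_mul_f h]
    simp only [proj, ← mul_assoc, t.e_mul_f_succ hi, zero_mul]
  · refine (t.isMatrixUnits _).mul_of_ne _ _ _ _ ?_
    rintro rfl
    exact hij rfl
  · rw [← t.proj_mul_f ⟨m, i, hi⟩, ← t.f_mul_f' h]
    simp only [proj, mul_assoc, t.f_succ_mul_e hj, mul_zero]

/-- A closed subalgebra containing all matrix units that link the distinguished units to
their splittings is everything. -/
theorem mem_of_forall_mem (T : NonUnitalStarSubalgebra ℂ B) (hT : IsClosed (T : Set B))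
    (h1 : 1 ∈ T)
    (he : ∀ n, ∀ i ∈ t.D n, t.e (n + 1) i (t.z (n + 1)) ∈ T) (x : B) : x ∈ T := by
  -- One column suffices: `e i j` is `e i z` times the adjoint of `e j z`, and units with an index
  -- outside `D n` are cut to zero.
  have hcorner : ∀ n, ∀ y ∈ matrixSpan (t.e (n + 1)), t.f n * y * t.f n ∈ T := by
    intro n y hy
    have hu := t.isMatrixUnits (n + 1)
    induction hy using Submodule.span_induction with
    | mem y hy =>
      obtain ⟨⟨i, j⟩, rfl⟩ := hy
      simp only
      by_cases hi : i ∈ t.D n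
      · by_cases hj : j ∈ t.D n
        · rw [t.f_mul_e hi, t.e_mul_f hj, ← hu.mul_same i (t.z (n + 1)) j, ← hu.star_eq j]
          exact mul_mem (he n i hi) (star_mem (he n j hj))
        · rw [mul_assoc, f, t.e_z, hu.mul_sum_of_notMem hj, mul_zero]
          exact zero_mem T
      · rw [f, t.e_z, hu.sum_mul_of_notMem hi, zero_mul]
        exact zero_mem T
    | zero => simp
    | add y y' _ _ h h' => rw [mul_add, add_mul]; exact add_mem h h'
    | smul c y _ h =>
      rw [mul_smul_comm, smul_mul_assoc]
      exact SMulMemClass.smul_mem c h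
  have hmul : ∀ n, ∀ y ∈ matrixSpan (t.e n), ∀ y' ∈ matrixSpan (t.e n),
      y * y' ∈ matrixSpan (t.e n) := by
    intro n y hy y' hy'
    induction hy using Submodule.span_induction with
    | mem y hy =>
      obtain ⟨⟨i, j⟩, rfl⟩ := hy
      induction hy' using Submodule.span_induction with
      | mem y' hy' =>
        obtain ⟨⟨i', j'⟩, rfl⟩ := hy'
        simp only
        by_cases h : j = i'
        · subst h
          rw [(t.isMatrixUnits n).mul_same]
          exact Submodule.subset_span ⟨(i, j'), rfl⟩
        · rw [(t.isMatrixUnits n).mul_of_ne _ _ _ _ h]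
          exact zero_mem _
      | zero => simp
      | add y y' _ _ h h' => rw [mul_add]; exact add_mem h h'
      | smul c y _ h => rw [mul_smul_comm]; exact Submodule.smul_mem _ c h
    | zero => simp
    | add y y' _ _ h h' => rw [add_mul]; exact add_mem h h'
    | smul c y _ h => rw [smul_mul_assoc]; exact Submodule.smul_mem _ c h
  have hall : ∀ n i j, t.e n i j ∈ T := by
    intro n
    induction n with
    | zero => exact fun i j => t.e_zero i j ▸ h1
    | succ n ih =>
      intro i j
      -- The units of stage `n`, in `T` by induction, move every block of a stage `n + 1` unit into
      -- the corner of `f n`, where `hcorner` applies.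
      rw [(t.isMatrixUnits n).eq_sum_sum (t.z n) (t.e (n + 1) i j)]
      refine sum_mem fun l _ => sum_mem fun l' _ => mul_mem (mul_mem (ih _ _) ?_) (ih _ _)
      exact hcorner n _ (hmul _ _ (hmul _ _ (t.mem_span _ _ _) _
        (Submodule.subset_span ⟨(i, j), rfl⟩)) _ (t.mem_span _ _ _))
  have hsub : closure (⋃ n, (matrixSpan (t.e n) : Set B)) ⊆ T := by
    refine closure_minimal (Set.iUnion_subset fun n => ?_) hT
    change matrixSpan (t.e n) ≤ T.toSubmodule
    rw [Submodule.span_le]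
    rintro _ ⟨p, rfl⟩
    exact hall n p.1 p.2
  exact hsub (t.dense x)

end MatrixTower

/-! ### The two generators -/

/-- A C⋆-algebra generated by commuting images of a separable unital C⋆-algebra and of a
C⋆-algebra with a tower of matrix units is singly generated. -/
theorem MatrixTower.isSinglyGenerated_of_commute {A B C : Type*} [CStarAlgebra A] [CStarAlgebra B]
    [CStarAlgebra C] [TopologicalSpace.SeparableSpace A] (t : MatrixTower B) (ι : A →⋆ₐ[ℂ] C)
    (κ : B →⋆ₐ[ℂ] C) (hcomm : ∀ a b, Commute (ι a) (κ b))
    (hgen : ∀ T : NonUnitalStarSubalgebra ℂ C, IsClosed (T : Set C) →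
      (∀ a b, ι a * κ b ∈ T) → T = ⊤) : IsSinglyGenerated C := by
  have hsep : TopologicalSpace.SeparableSpace (selfAdjoint A) :=
    (TopologicalSpace.IsSeparable.of_separableSpace (selfAdjoint A : Set A)).separableSpace
  have hκ : Continuous κ :=
    AddMonoidHomClass.continuous_of_bound κ 1 fun x => by
      simpa using NonUnitalStarAlgHom.norm_apply_le κ x
  have hι : Continuous ι :=
    AddMonoidHomClass.continuous_of_bound ι 1 fun x => by
      simpa using NonUnitalStarAlgHom.norm_apply_le ι x
  set d : ℕ → selfAdjoint A := TopologicalSpace.denseSeq (selfAdjoint A) with hd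
  have hw : ∀ n, t.w n ∈ (t.D n).erase (t.z (n + 1)) := fun n =>
    Finset.mem_erase.2 ⟨t.w_ne n, t.w_mem n⟩
  set e : ∀ n, Fin (t.k (n + 1)) → C := fun n i => κ (t.e (n + 1) i i) with he
  -- The term from `A` sits at `w n` and not at `z (n + 1)`, so the compression of `y n` to `f (n +
  -- 1)` stays zero. The link has zero diagonal, so different cuts separate the two terms.
  set y : ℕ → C := fun n => κ (t.link n) + ι (d n) * e n (t.w n) with hy
  obtain ⟨a, ha, hproj⟩ := exists_isSelfAdjoint_forall_mem_of_orthogonal (fun j => κ (t.proj j))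
    (fun j => (t.isStarProjection_proj j).map κ)
    (fun i j hij => by rw [← map_mul, t.proj_mul_proj hij, map_zero])
  obtain ⟨b, hb, hcut⟩ := exists_isSelfAdjoint_mul_mul_eq (fun n => κ (t.f n)) y
    (fun m n h => by simp only [← map_mul, t.f_mul_f h])
    (fun m n h => by simp only [← map_mul, t.f_mul_f' h])
    (fun n => by
      refine ((t.isSelfAdjoint_link n).map κ).add ?_
      rw [isSelfAdjoint_iff, star_mul, ← map_star ι, (d n).2.star_eq]
      rw [((t.isMatrixUnits _).isStarProjection _).isSelfAdjoint.map κ |>.star_eq]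
      exact (hcomm _ _).symm)
    (fun n => by
      simp only [hy, he]
      rw [mul_add, ← map_mul, t.f_mul_link, ← mul_assoc, ← (hcomm _ _).eq, mul_assoc, ← map_mul,
        t.f_mul_e (t.w_mem n)])
    (fun n => by
      simp only [hy, he]
      rw [mul_add, add_mul, ← map_mul, ← map_mul, t.f_succ_mul_link_mul, map_zero, ← mul_assoc,
        ← (hcomm _ _).eq, mul_assoc, mul_assoc, ← map_mul, t.e_mul_f_succ (hw n)]
      simp)
  refine ⟨a, b, ha, hb, ?_⟩
  set T := (NonUnitalStarAlgebra.adjoin ℂ ({a, b} : Set C)).topologicalClosure with hTdef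
  have hT : IsClosed (T : Set C) := NonUnitalStarSubalgebra.isClosed_topologicalClosure _
  have hle : ({a, b} : Set C) ⊆ T :=
    (NonUnitalStarAlgebra.subset_adjoin ℂ _).trans
      (NonUnitalStarSubalgebra.le_topologicalClosure _)
  have haT : a ∈ T := hle (by simp)
  have hbT : b ∈ T := hle (by simp)
  obtain ⟨h1, hp⟩ := hproj T hT haT
  have heT : ∀ n, ∀ i ∈ (t.D n).erase (t.z (n + 1)), e n i ∈ T := fun n i hi => hp ⟨n, i, hi⟩
  have hf : ∀ n, κ (t.f n) ∈ T := by
    intro n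
    induction n with
    | zero => rwa [t.f_zero, map_one]
    | succ n ih =>
      rw [t.f_succ, map_sub, map_sum]
      exact sub_mem ih (sum_mem fun i hi => heT n i hi)
  have hlink : ∀ n, ∀ i ∈ t.D n, κ (t.e (n + 1) i (t.z (n + 1))) ∈ T := by
    intro n i hi
    by_cases hz : i = t.z (n + 1)
    · rw [hz]
      exact hf (n + 1)
    have hi' : i ∈ (t.D n).erase (t.z (n + 1)) := Finset.mem_erase.2 ⟨hz, hi⟩
    obtain ⟨c, hc, hcut⟩ := hcut n
    have := hcut (e n i) (κ (t.f (n + 1))) (by simp only [he]; rw [← map_mul, t.e_mul_f hi])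
      (by rw [← map_mul, t.f_mul_f_succ])
      (by simp only [he]; rw [← map_mul, t.e_mul_f_succ hi', map_zero])
    -- The diagonal term drops out because the unit at `w n` is orthogonal to `f (n + 1)`.
    have hval : e n i * y n * κ (t.f (n + 1)) = κ (t.e (n + 1) i (t.z (n + 1))) := by
      simp only [he, hy]
      rw [mul_add, add_mul, ← map_mul, ← map_mul, t.e_mul_link_mul_f hi', mul_assoc, mul_assoc,
        ← map_mul, t.e_mul_f_succ (hw n)]
      simp
    rw [hval] at this
    have hmem : c • κ (t.e (n + 1) i (t.z (n + 1))) ∈ T := by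
      rw [← this]
      exact mul_mem (mul_mem (heT n i hi') hbT) (hf (n + 1))
    simpa [smul_smul, inv_mul_cancel₀ hc] using SMulMemClass.smul_mem c⁻¹ hmem
  have hdiag : ∀ n, ι (d n) * e n (t.w n) ∈ T := by
    intro n
    obtain ⟨c, hc, hcut⟩ := hcut n
    have hee : e n (t.w n) * e n (t.w n) = e n (t.w n) := by
      simp only [he]
      rw [← map_mul, (t.isMatrixUnits _).mul_same]
    have := hcut (e n (t.w n)) (e n (t.w n))
      (by simp only [he]; rw [← map_mul, t.e_mul_f (t.w_mem n)])
      (by simp only [he]; rw [← map_mul, t.f_mul_e (t.w_mem n)])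
      (by simp only [he]; rw [← map_mul, t.e_mul_f_succ (hw n), map_zero])
    have hval : e n (t.w n) * y n * e n (t.w n) = ι (d n) * e n (t.w n) := by
      have h0 : e n (t.w n) * κ (t.link n) * e n (t.w n) = 0 := by
        simp only [he]
        rw [← map_mul, ← map_mul, t.e_mul_link_mul_e (hw n), map_zero]
      rw [hy, mul_add, add_mul, h0, zero_add, ← mul_assoc, ← (hcomm _ _).eq, mul_assoc, mul_assoc,
        hee, hee]
    rw [hval] at this
    have hmem : c • (ι (d n) * e n (t.w n)) ∈ T := by
      rw [← this]
      exact mul_mem (mul_mem (heT n _ (hw n)) hbT) (heT n _ (hw n))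
    simpa [smul_smul, inv_mul_cancel₀ hc] using SMulMemClass.smul_mem c⁻¹ hmem
  have hκT : ∀ x, κ x ∈ T := fun x =>
    t.mem_of_forall_mem (T.comap κ) (hT.preimage hκ) (by simpa using h1) hlink x
  have hdT : ∀ n, ι (d n) ∈ T := by
    intro n
    have hu := t.isMatrixUnits (n + 1)
    -- Conjugation by matrix units copies the entry at `w n` to every diagonal position; since `ι (d
    -- n)` commutes with them, the copies add up to `ι (d n)`.
    have : ι (d n) = ∑ l, κ (t.e (n + 1) l (t.w n)) * (ι (d n) * e n (t.w n)) *
        κ (t.e (n + 1) (t.w n) l) := by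
      have key : ∀ l, κ (t.e (n + 1) l (t.w n)) * (ι (d n) * e n (t.w n)) *
          κ (t.e (n + 1) (t.w n) l) = ι (d n) * κ (t.e (n + 1) l l) := by
        intro l
        rw [← mul_assoc, ← (hcomm _ _).eq, mul_assoc, mul_assoc]
        simp only [he]
        rw [← map_mul, ← map_mul, hu.mul_same, hu.mul_same]
      simp only [key, ← Finset.mul_sum, ← map_sum, hu.sum_eq, map_one, mul_one]
    rw [this]
    exact sum_mem fun l _ => mul_mem (mul_mem (hκT _) (hdiag n)) (hκT _)
  have hsaT : ∀ x : selfAdjoint A, ι x ∈ T := by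
    intro x
    have hcl : IsClosed {x : selfAdjoint A | ι x ∈ T} :=
      hT.preimage (hι.comp continuous_subtype_val)
    exact hcl.closure_subset_iff.2 (Set.range_subset_iff.2 hdT)
      (TopologicalSpace.denseRange_denseSeq (selfAdjoint A) x)
  refine hgen T hT fun x x' => mul_mem ?_ (hκT x')
  rw [← realPart_add_I_smul_imaginaryPart x, map_add, map_smul]
  exact add_mem (hsaT _) (SMulMemClass.smul_mem _ (hsaT _))

/-! ### The two factors inside the tensor product -/

namespace CStarTensor

variable (A : Type u) (B : Type v) [CStarAlgebra A] [CStarAlgebra B]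

theorem ofAlg_one : (ofAlg (1 : A ⊗[ℂ] B) : CStarTensor A B) = 1 :=
  Completion.coe_one (α := Alg A B)

/-- The canonical map from the algebraic tensor product, as a linear map. -/
def ofAlgLinear : A ⊗[ℂ] B →ₗ[ℂ] CStarTensor A B where
  toFun := ofAlg
  map_add' := ofAlg_add
  map_smul' := ofAlg_smul

/-- The embedding `a ↦ a ⊗ 1` of the first factor. -/
def inl : A →⋆ₐ[ℂ] CStarTensor A B where
  __ := AlgHom.ofLinearMap ((ofAlgLinear A B).comp ((TensorProduct.mk ℂ A B).flip 1))
    (ofAlg_one A B) fun x y => by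
      change ofAlg ((x * y) ⊗ₜ[ℂ] (1 : B)) = ofAlg (x ⊗ₜ[ℂ] (1 : B)) * ofAlg (y ⊗ₜ[ℂ] (1 : B))
      rw [← ofAlg_mul, Algebra.TensorProduct.tmul_mul_tmul, one_mul]
  map_star' x := by
    change ofAlg (star x ⊗ₜ[ℂ] (1 : B)) = star (ofAlg (x ⊗ₜ[ℂ] (1 : B)))
    rw [star_ofAlg, TensorProduct.star_tmul, star_one]

/-- The embedding `b ↦ 1 ⊗ b` of the second factor. -/
def inr : B →⋆ₐ[ℂ] CStarTensor A B where
  __ := AlgHom.ofLinearMap ((ofAlgLinear A B).comp (TensorProduct.mk ℂ A B 1))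
    (ofAlg_one A B) fun x y => by
      change ofAlg ((1 : A) ⊗ₜ[ℂ] (x * y)) = ofAlg ((1 : A) ⊗ₜ[ℂ] x) * ofAlg ((1 : A) ⊗ₜ[ℂ] y)
      rw [← ofAlg_mul, Algebra.TensorProduct.tmul_mul_tmul, one_mul]
  map_star' x := by
    change ofAlg ((1 : A) ⊗ₜ[ℂ] star x) = star (ofAlg ((1 : A) ⊗ₜ[ℂ] x))
    rw [star_ofAlg, TensorProduct.star_tmul, star_one]

variable {A B}

theorem inl_mul_inr (a : A) (b : B) : inl A B a * inr A B b = ofAlg (a ⊗ₜ[ℂ] b) := by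
  change ofAlg (a ⊗ₜ[ℂ] (1 : B)) * ofAlg ((1 : A) ⊗ₜ[ℂ] b) = _
  rw [← ofAlg_mul, Algebra.TensorProduct.tmul_mul_tmul, one_mul, mul_one]

theorem commute_inl_inr (a : A) (b : B) : Commute (inl A B a) (inr A B b) := by
  rw [commute_iff_eq, inl_mul_inr]
  change _ = ofAlg ((1 : A) ⊗ₜ[ℂ] b) * ofAlg (a ⊗ₜ[ℂ] (1 : B))
  rw [← ofAlg_mul, Algebra.TensorProduct.tmul_mul_tmul, one_mul, mul_one]

theorem eq_top_of_inl_mul_inr_mem (T : NonUnitalStarSubalgebra ℂ (CStarTensor A B))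
    (hT : IsClosed (T : Set (CStarTensor A B))) (h : ∀ a b, inl A B a * inr A B b ∈ T) :
    T = ⊤ := by
  refine eq_top_iff.2 fun x _ => ?_
  refine denseRange_ofAlg.induction_on (p := fun x => x ∈ T) x hT fun x => ?_
  induction x using TensorProduct.induction_on with
  | zero =>
    rw [← TensorProduct.zero_tmul A (0 : B), ← inl_mul_inr]
    exact h 0 0
  | tmul a b => exact inl_mul_inr a b ▸ h a b
  | add x y hx hy => rw [ofAlg_add]; exact add_mem hx hy

end CStarTensor

end

theorem corollary3p1 (A : Type u) (B : Type v) [CStarAlgebra A] [CStarAlgebra B]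
    [TopologicalSpace.SeparableSpace A] (hB : IsUHF B) :
    IsSinglyGenerated (CStarTensor A B) := by
  obtain ⟨t⟩ := hB.nonempty_matrixTower
  exact t.isSinglyGenerated_of_commute (CStarTensor.inl A B) (CStarTensor.inr A B)
    CStarTensor.commute_inl_inr CStarTensor.eq_top_of_inl_mul_inr_mem
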